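/- Let $\mathcal A$ be a set of atomic types. The m-types are given by $A ::= \alpha \mid \alpha^{\bot} \mid A\wedge A \mid A\vee A$ with $\alpha\in\mathcal A$, and the types by $C ::= A \mid \bot$. Negation of m-types is defined by $(\alpha)^{\bot}=\alpha^{\bot}$, $(\alpha^{\bot})^{\bot}=\alpha$, $(A\wedge B)^{\bot}=A^{\bot}\vee B^{\bot}$, $(A\vee B)^{\bot}=A^{\bot}\wedge B^{\bot}$. Terms, taken up to renaming of bound variables, are given by $P ::= x \mid \langle P,P\rangle \mid \sigma_1(P)\mid\sigma_2(P)\mid \lambda x\,P \mid (P\star P)$. A context $\Gamma$ is a finite set of declarations $x:A$ of distinct variables with m-types $A$, and the typing relation $\Gamma\vdash P:C$ is generated by the following rules (where $A,A_1,A_2$ are m-types and $i\in\{1,2\}$): * $\Gamma,x:A\vdash x:A$; * if $\Gamma\vdash P_1:A_1$ and $\Gamma\vdash P_2:A_2$, then $\Gamma\vdash\langle P_1,P_2\rangle:A_1\wedge A_2$; * if $\Gamma\vdash P:A_i$, then $\Gamma\vdash\sigma_i(P):A_1\vee A_2$; * if $\Gamma,x:A\vdash P:\bot$, then $\Gamma\vdash\lambda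 x\,P:A^{\bot}$; * if $\Gamma\vdash P_1:A^{\bot}$ and $\Gamma\vdash P_2:A$, then $\Gamma\vdash(P_1\star P_2):\bot$. Let $\rightarrow_{\beta\pi}$ be the compatible closure (closure under all term constructors) of the rules $$(\beta)\ (\lambda x P\star Q)\rightarrow P[x:=Q],\qquad (\beta^{\bot})\ (Q\star\lambda xP)\rightarrow P[x:=Q],$$ $$(\pi)\ (\langle P_1,P_2\rangle\star\sigma_i(Q))\rightarrow (P_i\star Q),\qquad (\pi^{\bot})\ (\sigma_i(Q)\star\langle P_1,P_2\rangle)\rightarrow(Q\star P_i)\qquad (i\in\{1,2\}).$$ **Theorem.** The typed $\lambda_{\beta\pi}$-calculus is strongly normalizing: if $\Gamma\vdash M:C$ for some context $\Gamma$ and some type $C$, then every $\rightarrow_{\beta\pi}$-reduction sequence starting from $M$ is finite. -/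

import Mathlib

namespace LambdaSym

universe u

/-- The m-types over a set `α` of atomic types: atomic types, negated atomic types,
conjunctions and disjunctions. -/
inductive MType (α : Type u) : Type u
  | atom (a : α) : MType α
  | natom (a : α) : MType α
  | and (A B : MType α) : MType α
  | or (A B : MType α) : MType α

/-- The (involutive) negation of an m-type. -/
def MType.neg {α : Type u} : MType α → MType α
  | .atom a => .natom a
  | .natom a => .atom a
  | .and A B => .or A.neg B.neg
  | .or A B => .and A.neg B.neg

/-- The types: the m-types, and the further type `⊥`. -/
inductive Ty (α : Type u) : Type u
  | m (A : MType α) : Ty α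
  | bot : Ty α

/-- The raw terms, up to renaming of bound variables (de Bruijn indices):
variables, `⟨P, Q⟩`, `σ₁(P)`, `σ₂(P)`, `λ x P` and `(P ⋆ Q)`. -/
inductive Term : Type
  | var (n : ℕ) : Term
  | pair (P Q : Term) : Term
  | inj₁ (P : Term) : Term
  | inj₂ (P : Term) : Term
  | lam (P : Term) : Term
  | star (P Q : Term) : Term

namespace Term

/-- Extension of a renaming under a binder. -/
def upRen (ξ : ℕ → ℕ) : ℕ → ℕ
  | 0 => 0
  | n + 1 => ξ n + 1

/-- Renaming of free variables. -/
def rename : (ℕ → ℕ) → Term → Term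
  | ξ, var n => var (ξ n)
  | ξ, pair P Q => pair (rename ξ P) (rename ξ Q)
  | ξ, inj₁ P => inj₁ (rename ξ P)
  | ξ, inj₂ P => inj₂ (rename ξ P)
  | ξ, lam P => lam (rename (upRen ξ) P)
  | ξ, star P Q => star (rename ξ P) (rename ξ Q)

/-- Extension of a simultaneous substitution under a binder. -/
def up (s : ℕ → Term) : ℕ → Term
  | 0 => var 0
  | n + 1 => rename Nat.succ (s n)

/-- Capture-avoiding simultaneous substitution. -/
def subst : (ℕ → Term) → Term → Term
  | s, var n => s n
  | s, pair P Q => pair (subst s P) (subst s Q)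
  | s, inj₁ P => inj₁ (subst s P)
  | s, inj₂ P => inj₂ (subst s P)
  | s, lam P => lam (subst (up s) P)
  | s, star P Q => star (subst s P) (subst s Q)

/-- The substitution that replaces the variable `0` by `Q` and lowers all other variables. -/
def single (Q : Term) : ℕ → Term
  | 0 => Q
  | n + 1 => var n

/-- `P[x := Q]`, where `x` is the variable bound by the `λ` in `λ x P`. -/
def inst (P Q : Term) : Term := subst (single Q) P

end Term

/-- The typing relation `Γ ⊢ M : C`. A context is a list of m-types: its `n`-th entry is the
type declared for the variable with index `n`. -/
inductive HasType {α : Type u} : List (MType α) → Term → Ty α → Prop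
  | var {Γ : List (MType α)} {n : ℕ} {A : MType α} :
      Γ[n]? = some A → HasType Γ (.var n) (.m A)
  | pair {Γ : List (MType α)} {P₁ P₂ : Term} {A₁ A₂ : MType α} :
      HasType Γ P₁ (.m A₁) → HasType Γ P₂ (.m A₂) →
      HasType Γ (.pair P₁ P₂) (.m (.and A₁ A₂))
  | inj₁ {Γ : List (MType α)} {P : Term} {A₁ A₂ : MType α} :
      HasType Γ P (.m A₁) → HasType Γ (.inj₁ P) (.m (.or A₁ A₂))
  | inj₂ {Γ : List (MType α)} {P : Term} {A₁ A₂ : MType α} :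
      HasType Γ P (.m A₂) → HasType Γ (.inj₂ P) (.m (.or A₁ A₂))
  | lam {Γ : List (MType α)} {P : Term} {A : MType α} :
      HasType (A :: Γ) P .bot → HasType Γ (.lam P) (.m A.neg)
  | star {Γ : List (MType α)} {P₁ P₂ : Term} {A : MType α} :
      HasType Γ P₁ (.m A.neg) → HasType Γ P₂ (.m A) → HasType Γ (.star P₁ P₂) .bot

/-- The reduction rules `β`, `β^⊥`, `π` and `π^⊥`, applied at the root of a term. -/
inductive Rule : Term → Term → Prop
  | beta (P Q : Term) : Rule (.star (.lam P) Q) (P.inst Q)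
  | betaPerp (P Q : Term) : Rule (.star Q (.lam P)) (P.inst Q)
  | pi₁ (P₁ P₂ Q : Term) : Rule (.star (.pair P₁ P₂) (.inj₁ Q)) (.star P₁ Q)
  | pi₂ (P₁ P₂ Q : Term) : Rule (.star (.pair P₁ P₂) (.inj₂ Q)) (.star P₂ Q)
  | piPerp₁ (P₁ P₂ Q : Term) : Rule (.star (.inj₁ Q) (.pair P₁ P₂)) (.star Q P₁)
  | piPerp₂ (P₁ P₂ Q : Term) : Rule (.star (.inj₂ Q) (.pair P₁ P₂)) (.star Q P₂)

/-- One-step reduction of the `λ_{βπ}`-calculus: the compatible closure of the rules. -/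
inductive Step : Term → Term → Prop
  | rule {M N : Term} : Rule M N → Step M N
  | pairLeft {P P' : Term} (Q : Term) : Step P P' → Step (.pair P Q) (.pair P' Q)
  | pairRight (P : Term) {Q Q' : Term} : Step Q Q' → Step (.pair P Q) (.pair P Q')
  | inj₁ {P P' : Term} : Step P P' → Step (.inj₁ P) (.inj₁ P')
  | inj₂ {P P' : Term} : Step P P' → Step (.inj₂ P) (.inj₂ P')
  | lam {P P' : Term} : Step P P' → Step (.lam P) (.lam P')
  | starLeft {P P' : Term} (Q : Term) : Step P P' → Step (.star P Q) (.star P' Q)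
  | starRight (P : Term) {Q Q' : Term} : Step Q Q' → Step (.star P Q) (.star P Q')

/-- `M` is strongly normalizable: every reduction sequence starting from `M` is finite. -/
def StronglyNormalizable (M : Term) : Prop :=
  ¬ ∃ f : ℕ → Term, f 0 = M ∧ ∀ n, Step (f n) (f (n + 1))

end LambdaSym

/-!
The proof uses symmetric reducibility candidates. An m-type `A` and its negation are interpreted
together, by sets `X` and `Y` of strongly normalizing terms. An abstraction `λ x P` should belong to
`X` as soon as `P[x := Q]` is strongly normalizing for all `Q ∈ Y`, and vice versa, so `X` and `Y`
cannot be defined by recursion on `A` alone: this requirement determines each set from the other in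
an order-reversing way. The composition of the two order-reversing operators is monotone, and
its least fixed point (Knaster–Tarski) yields `X`, hence `Y`. A cut `P ⋆ Q` between `X` and `Y` is
then strongly normalizing by induction on the reductions of `P` and `Q`: its `β` reducts are
controlled by the fixed point equations, and its `π` reducts are cuts at the components of `A`.
-/

namespace LambdaSym

namespace Term

theorem up_var : up var = var := by
  funext n
  cases n <;> rfl

theorem subst_var (M : Term) : subst var M = M := by
  induction M <;> simp_all [subst, up_var]

theorem up_comp_upRen (s : ℕ → Term) (ξ : ℕ → ℕ) : up s ∘ upRen ξ = up (s ∘ ξ) := by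
  funext n
  cases n <;> rfl

theorem subst_rename (M : Term) (s : ℕ → Term) (ξ : ℕ → ℕ) :
    subst s (rename ξ M) = subst (s ∘ ξ) M := by
  induction M generalizing s ξ <;> simp_all [subst, rename, up_comp_upRen]

theorem upRen_comp_upRen (ξ ζ : ℕ → ℕ) : upRen ξ ∘ upRen ζ = upRen (ξ ∘ ζ) := by
  funext n
  cases n <;> rfl

theorem rename_rename (M : Term) (ξ ζ : ℕ → ℕ) :
    rename ξ (rename ζ M) = rename (ξ ∘ ζ) M := by
  induction M generalizing ξ ζ <;> simp_all [rename, upRen_comp_upRen]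

theorem rename_upRen_comp_up (ξ : ℕ → ℕ) (s : ℕ → Term) :
    rename (upRen ξ) ∘ up s = up (rename ξ ∘ s) := by
  funext n
  cases n with
  | zero => rfl
  | succ n =>
    simp only [Function.comp_apply, up, rename_rename]
    rfl

theorem rename_subst (M : Term) (ξ : ℕ → ℕ) (s : ℕ → Term) :
    rename ξ (subst s M) = subst (rename ξ ∘ s) M := by
  induction M generalizing ξ s <;> simp_all [subst, rename, rename_upRen_comp_up]

theorem subst_up_comp_up (t s : ℕ → Term) : subst (up t) ∘ up s = up (subst t ∘ s) := by
  funext n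
  cases n with
  | zero => rfl
  | succ n =>
    simp only [Function.comp_apply, up, subst_rename, rename_subst]
    rfl

theorem subst_subst (M : Term) (t s : ℕ → Term) :
    subst t (subst s M) = subst (subst t ∘ s) M := by
  induction M generalizing t s <;> simp_all [subst, subst_up_comp_up]

/-- The extension `(Q, s 0, s 1, …)` of a simultaneous substitution `s` by a term `Q` for the
variable `0`. -/
def cons (Q : Term) (s : ℕ → Term) : ℕ → Term
  | 0 => Q
  | n + 1 => s n

theorem inst_subst_up (P Q : Term) (s : ℕ → Term) :
    (subst (up s) P).inst Q = subst (cons Q s) P := by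
  have h : subst (single Q) ∘ up s = cons Q s := by
    funext n
    cases n with
    | zero => rfl
    | succ n => exact (subst_rename (s n) _ _).trans (subst_var (s n))
  rw [inst, subst_subst, h]

theorem subst_inst (P Q : Term) (s : ℕ → Term) :
    subst s (P.inst Q) = (subst (up s) P).inst (subst s Q) := by
  have h : subst s ∘ single Q = cons (subst s Q) s := by
    funext n
    cases n <;> rfl
  rw [inst_subst_up, inst, subst_subst, h]

end Term

open Term

theorem Rule.subst {M N : Term} (h : Rule M N) (s : ℕ → Term) : Rule (M.subst s) (N.subst s) := by
  cases h <;> simp only [Term.subst, subst_inst] <;> constructor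

theorem Step.subst {M N : Term} (h : Step M N) (s : ℕ → Term) : Step (M.subst s) (N.subst s) := by
  induction h generalizing s with
  | rule h => exact .rule (h.subst s)
  | pairLeft _ _ ih => exact .pairLeft _ (ih s)
  | pairRight _ _ ih => exact .pairRight _ (ih s)
  | inj₁ _ ih => exact .inj₁ (ih s)
  | inj₂ _ ih => exact .inj₂ (ih s)
  | lam _ ih => exact .lam (ih _)
  | starLeft _ _ ih => exact .starLeft _ (ih s)
  | starRight _ _ ih => exact .starRight _ (ih s)

theorem Step.inst {P P' : Term} (h : Step P P') (Q : Term) : Step (P.inst Q) (P'.inst Q) :=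
  h.subst _

theorem not_step_var (n : ℕ) (N : Term) : ¬ Step (var n) N := by
  rintro ⟨⟨⟩⟩

theorem step_pair_iff {P Q N : Term} :
    Step (pair P Q) N ↔
      (∃ P', Step P P' ∧ pair P' Q = N) ∨ ∃ Q', Step Q Q' ∧ pair P Q' = N := by
  constructor
  · intro hN
    cases hN with
    | rule h => cases h
    | pairLeft _ h => exact .inl ⟨_, h, rfl⟩
    | pairRight _ h => exact .inr ⟨_, h, rfl⟩
  · rintro (⟨P', h, rfl⟩ | ⟨Q', h, rfl⟩)
    exacts [.pairLeft _ h, .pairRight _ h]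

theorem step_inj₁_iff {P N : Term} : Step (inj₁ P) N ↔ ∃ P', Step P P' ∧ inj₁ P' = N := by
  constructor
  · intro hN
    cases hN with
    | rule h => cases h
    | inj₁ h => exact ⟨_, h, rfl⟩
  · rintro ⟨P', h, rfl⟩
    exact .inj₁ h

theorem step_inj₂_iff {P N : Term} : Step (inj₂ P) N ↔ ∃ P', Step P P' ∧ inj₂ P' = N := by
  constructor
  · intro hN
    cases hN with
    | rule h => cases h
    | inj₂ h => exact ⟨_, h, rfl⟩
  · rintro ⟨P', h, rfl⟩
    exact .inj₂ h

theorem step_lam_iff {P N : Term} : Step (lam P) N ↔ ∃ P', Step P P' ∧ lam P' = N := by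
  constructor
  · intro hN
    cases hN with
    | rule h => cases h
    | lam h => exact ⟨_, h, rfl⟩
  · rintro ⟨P', h, rfl⟩
    exact .lam h

/-- Strong normalization as accessibility for the converse of one-step reduction; this is the form
that provides induction on the reducts of a term. -/
def SN (M : Term) : Prop := Acc (fun N M => Step M N) M

theorem stronglyNormalizable_iff_sn {M : Term} : StronglyNormalizable M ↔ SN M :=
  (not_congr (not_acc_iff_exists_descending_chain (r := fun N M => Step M N))).symm.trans not_not

namespace SN

variable {P Q : Term}

theorem of_step (h : ∀ N, Step P N → SN N) : SN P := Acc.intro _ h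

theorem step (h : SN P) (hPQ : Step P Q) : SN Q := Acc.inv h hPQ

theorem induction₂ {C : Term → Term → Prop} (hP : SN P) (hQ : SN Q)
    (ih : ∀ P Q, (∀ P', Step P P' → C P' Q) → (∀ Q', Step Q Q' → C P Q') → C P Q) : C P Q := by
  induction hP generalizing Q with
  | intro P _ ihP =>
    induction hQ with
    | intro Q hQ ihQ => exact ih P Q (fun P' h => ihP P' h (Acc.intro Q hQ)) ihQ

theorem of_map {F : Term → Term} (hF : ∀ P P', Step P P' → Step (F P) (F P')) (h : SN (F P)) :
    SN P :=
  Subrelation.accessible (hF _ _) (InvImage.accessible F h)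

theorem of_inst (h : SN (P.inst Q)) : SN P := of_map (fun _ _ hP => hP.inst Q) h

theorem var (n : ℕ) : SN (var n) := of_step fun N h => (not_step_var n N h).elim

theorem lam (h : SN P) : SN (lam P) := Acc.of_fibration Term.lam (fun _ _ => step_lam_iff.1) h

theorem inj₁ (h : SN P) : SN (inj₁ P) := Acc.of_fibration Term.inj₁ (fun _ _ => step_inj₁_iff.1) h

theorem inj₂ (h : SN P) : SN (inj₂ P) := Acc.of_fibration Term.inj₂ (fun _ _ => step_inj₂_iff.1) h

theorem pair (hP : SN P) (hQ : SN Q) : SN (pair P Q) := by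
  refine induction₂ hP hQ fun P Q ihP ihQ => of_step fun N hN => ?_
  obtain ⟨P', h, rfl⟩ | ⟨Q', h, rfl⟩ := step_pair_iff.1 hN
  exacts [ihP P' h, ihQ Q' h]

end SN

/-- A set of strongly normalizing terms that is closed under reduction. -/
structure Stable (X : Set Term) : Prop where
  sn : ∀ {M}, M ∈ X → SN M
  step : ∀ {M N}, M ∈ X → Step M N → N ∈ X

/-- Every cut of an element of `X` (on the left) against an element of `Y` (on the right) is
strongly normalizing. -/
def Orthogonal (X Y : Set Term) : Prop := ∀ P ∈ X, ∀ Q ∈ Y, SN (star P Q)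

/-- The weakening of `Orthogonal X Y` that only concerns the reducts of a cut obtained by applying
a rule at its root. -/
def RootOrthogonal (X Y : Set Term) : Prop :=
  ∀ P ∈ X, ∀ Q ∈ Y, ∀ N, Rule (star P Q) N → SN N

theorem RootOrthogonal.orthogonal {X Y : Set Term} (h : RootOrthogonal X Y) (hX : Stable X)
    (hY : Stable Y) : Orthogonal X Y := by
  intro P hP Q hQ
  refine SN.induction₂ (C := fun P Q => P ∈ X → Q ∈ Y → SN (star P Q)) (hX.sn hP) (hY.sn hQ)
    (fun P Q ihP ihQ hP hQ => .of_step fun N hN => ?_) hP hQ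
  cases hN with
  | rule hN => exact h P hP Q hQ N hN
  | starLeft _ hPP' => exact ihP _ hPP' (hX.step hP hPP') hQ
  | starRight _ hQQ' => exact ihQ _ hQQ' hP (hY.step hQ hQQ')

/-- The terms `⟨P, Q⟩` with `P ∈ X` and `Q ∈ Y`. -/
def pairSet (X Y : Set Term) : Set Term := Set.image2 pair X Y

/-- The terms `σ₁(P)` with `P ∈ X` and the terms `σ₂(Q)` with `Q ∈ Y`. -/
def injSet (X Y : Set Term) : Set Term := inj₁ '' X ∪ inj₂ '' Y

section Connectives

variable {X X' Y Y' : Set Term}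

theorem Stable.pairSet (hX : Stable X) (hY : Stable Y) : Stable (pairSet X Y) where
  sn := by
    rintro _ ⟨P, hP, Q, hQ, rfl⟩
    exact (hX.sn hP).pair (hY.sn hQ)
  step := by
    rintro _ N ⟨P, hP, Q, hQ, rfl⟩ hN
    obtain ⟨P', h, rfl⟩ | ⟨Q', h, rfl⟩ := step_pair_iff.1 hN
    · exact ⟨P', hX.step hP h, Q, hQ, rfl⟩
    · exact ⟨P, hP, Q', hY.step hQ h, rfl⟩

theorem Stable.injSet (hX : Stable X) (hY : Stable Y) : Stable (injSet X Y) where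
  sn := by
    rintro _ (⟨P, hP, rfl⟩ | ⟨Q, hQ, rfl⟩)
    · exact (hX.sn hP).inj₁
    · exact (hY.sn hQ).inj₂
  step := by
    rintro _ N (⟨P, hP, rfl⟩ | ⟨Q, hQ, rfl⟩) hN
    · obtain ⟨P', h, rfl⟩ := step_inj₁_iff.1 hN
      exact .inl ⟨P', hX.step hP h, rfl⟩
    · obtain ⟨Q', h, rfl⟩ := step_inj₂_iff.1 hN
      exact .inr ⟨Q', hY.step hQ h, rfl⟩

theorem rootOrthogonal_pairSet_injSet (hX : Orthogonal X X') (hY : Orthogonal Y Y') :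
    RootOrthogonal (pairSet X Y) (injSet X' Y') := by
  rintro _ ⟨P, hP, Q, hQ, rfl⟩ _ (⟨R, hR, rfl⟩ | ⟨R, hR, rfl⟩) N ⟨⟩
  exacts [hX P hP R hR, hY Q hQ R hR]

theorem rootOrthogonal_injSet_pairSet (hX : Orthogonal X X') (hY : Orthogonal Y Y') :
    RootOrthogonal (injSet X Y) (pairSet X' Y') := by
  rintro _ (⟨R, hR, rfl⟩ | ⟨R, hR, rfl⟩) _ ⟨P, hP, Q, hQ, rfl⟩ N ⟨⟩
  exacts [hX R hR P hP, hY R hR Q hQ]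

end Connectives

/-- One half `X` of a symmetric reducibility candidate whose other half is `Y`. -/
structure IsCandidate (X Y : Set Term) : Prop extends Stable X where
  var_mem : ∀ n, var n ∈ X
  lam_mem : ∀ {P}, (∀ Q ∈ Y, SN (P.inst Q)) → lam P ∈ X
  orthogonal : Orthogonal X Y

/-- A base `B`, relative to `C`, for one half of a symmetric reducibility candidate: `B` and `C`
generate a candidate if each is a base relative to the other. -/
structure IsCandidateBase (B C : Set Term) : Prop extends Stable B where
  lam_notMem : ∀ P, lam P ∉ B
  rootOrthogonal : RootOrthogonal B C

theorem isCandidateBase_empty (C : Set Term) : IsCandidateBase ∅ C where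
  sn h := h.elim
  step h := h.elim
  lam_notMem _ h := h
  rootOrthogonal _ h := h.elim

theorem IsCandidate.isCandidateBase_pairSet {X X' Y Y' : Set Term} (hX : IsCandidate X X')
    (hY : IsCandidate Y Y') : IsCandidateBase (pairSet X Y) (injSet X' Y') where
  toStable := hX.toStable.pairSet hY.toStable
  lam_notMem := by
    rintro P ⟨_, _, _, _, ⟨⟩⟩
  rootOrthogonal := rootOrthogonal_pairSet_injSet hX.orthogonal hY.orthogonal

theorem IsCandidate.isCandidateBase_injSet {X X' Y Y' : Set Term} (hX : IsCandidate X X')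
    (hY : IsCandidate Y Y') : IsCandidateBase (injSet X Y) (pairSet X' Y') where
  toStable := hX.toStable.injSet hY.toStable
  lam_notMem := by
    rintro P (⟨_, _, ⟨⟩⟩ | ⟨_, _, ⟨⟩⟩)
  rootOrthogonal := rootOrthogonal_injSet_pairSet hX.orthogonal hY.orthogonal

/-- The operator that determines one half of a candidate from the other half `Y`: it adds to `B` all
variables, and all abstractions whose instances by elements of `Y` are strongly normalizing. -/
def close (B Y : Set Term) : Set Term :=
  B ∪ Set.range var ∪ lam '' {P | ∀ Q ∈ Y, SN (P.inst Q)}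

section Close

variable {B C X Y : Set Term} {P Q : Term}

theorem subset_close : B ⊆ close B Y := fun _ h => .inl (.inl h)

theorem var_mem_close (n : ℕ) : var n ∈ close B Y := .inl (.inr ⟨n, rfl⟩)

theorem lam_mem_close (hP : ∀ Q ∈ Y, SN (P.inst Q)) : lam P ∈ close B Y := .inr ⟨P, hP, rfl⟩

theorem IsCandidateBase.sn_inst_of_lam_mem_close (hB : IsCandidateBase B C)
    (hP : lam P ∈ close B Y) (hQ : Q ∈ Y) : SN (P.inst Q) := by
  obtain (h | ⟨_, ⟨⟩⟩) | ⟨_, h, ⟨⟩⟩ := hP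
  exacts [(hB.lam_notMem P h).elim, h Q hQ]

theorem pair_mem_close_iff : pair P Q ∈ close B Y ↔ pair P Q ∈ B := by simp [close]

theorem inj₁_mem_close_iff : inj₁ P ∈ close B Y ↔ inj₁ P ∈ B := by simp [close]

theorem inj₂_mem_close_iff : inj₂ P ∈ close B Y ↔ inj₂ P ∈ B := by simp [close]

theorem close_antitone (B : Set Term) : Antitone (close B) := fun _ _ h =>
  Set.union_subset_union_right _ (Set.image_mono fun _ hP Q hQ => hP Q (h hQ))

theorem Stable.close (hB : Stable B) (hY : Y.Nonempty) : Stable (close B Y) where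
  sn := by
    rintro _ ((h | ⟨n, rfl⟩) | ⟨P, hP, rfl⟩)
    · exact hB.sn h
    · exact .var n
    · obtain ⟨Q, hQ⟩ := hY
      exact (hP Q hQ).of_inst.lam
  step := by
    rintro _ N ((h | ⟨n, rfl⟩) | ⟨P, hP, rfl⟩) hN
    · exact subset_close (hB.step h hN)
    · exact (not_step_var n N hN).elim
    · obtain ⟨P', h, rfl⟩ := step_lam_iff.1 hN
      exact lam_mem_close fun Q hQ => (hP Q hQ).step (h.inst Q)

theorem IsCandidateBase.rootOrthogonal_close (hB : IsCandidateBase B C) (hC : IsCandidateBase C B)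
    (hX : close B Y = X) (hY : close C X = Y) : RootOrthogonal X Y := by
  intro P hP Q hQ N hN
  have hP' : P ∈ close B Y := hX ▸ hP
  have hQ' : Q ∈ close C X := hY ▸ hQ
  have hBC : P ∈ B → Q ∈ C → SN N := fun hP hQ => hB.rootOrthogonal P hP Q hQ N hN
  cases hN with
  | beta => exact hB.sn_inst_of_lam_mem_close hP' hQ
  | betaPerp => exact hC.sn_inst_of_lam_mem_close hQ' hP
  | pi₁ => exact hBC (pair_mem_close_iff.1 hP') (inj₁_mem_close_iff.1 hQ')
  | pi₂ => exact hBC (pair_mem_close_iff.1 hP') (inj₂_mem_close_iff.1 hQ')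
  | piPerp₁ => exact hBC (inj₁_mem_close_iff.1 hP') (pair_mem_close_iff.1 hQ')
  | piPerp₂ => exact hBC (inj₂_mem_close_iff.1 hP') (pair_mem_close_iff.1 hQ')

theorem IsCandidateBase.isCandidate (hB : IsCandidateBase B C) (hC : IsCandidateBase C B)
    (hX : close B Y = X) (hY : close C X = Y) : IsCandidate X Y := by
  have var_mem_X (n : ℕ) : var n ∈ X := hX ▸ var_mem_close n
  have var_mem_Y (n : ℕ) : var n ∈ Y := hY ▸ var_mem_close n
  have stable_X : Stable X := hX ▸ hB.toStable.close ⟨_, var_mem_Y 0⟩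
  have stable_Y : Stable Y := hY ▸ hC.toStable.close ⟨_, var_mem_X 0⟩
  exact
    { toStable := stable_X
      var_mem := var_mem_X
      lam_mem := fun hP => hX ▸ lam_mem_close hP
      orthogonal := (hB.rootOrthogonal_close hC hX hY).orthogonal stable_X stable_Y }

end Close

/-- The least set `X` with `close B (close C X) = X`. -/
def closeFix (B C : Set Term) : Set Term :=
  OrderHom.lfp ⟨close B ∘ close C, (close_antitone B).comp (close_antitone C)⟩

theorem close_close_closeFix (B C : Set Term) : close B (close C (closeFix B C)) = closeFix B C :=
  OrderHom.map_lfp ⟨close B ∘ close C, _⟩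

/-- A symmetric reducibility candidate: the interpretations of an m-type and of its negation. -/
structure Candidate where
  pos : Set Term
  neg : Set Term
  isCandidate_pos : IsCandidate pos neg
  isCandidate_neg : IsCandidate neg pos

namespace Candidate

/-- The candidate generated by a base. Its positive half is a least fixed point, from which the
negative half is read off; any other fixed point would do as well. -/
def generate {B C : Set Term} (hB : IsCandidateBase B C) (hC : IsCandidateBase C B) :
    Candidate where
  pos := closeFix B C
  neg := close C (closeFix B C)
  isCandidate_pos := hB.isCandidate hC (close_close_closeFix B C) rfl
  isCandidate_neg := hC.isCandidate hB rfl (close_close_closeFix B C)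

theorem subset_generate_pos {B C : Set Term} (hB : IsCandidateBase B C)
    (hC : IsCandidateBase C B) : B ⊆ (generate hB hC).pos :=
  subset_close.trans (close_close_closeFix B C).subset

theorem subset_generate_neg {B C : Set Term} (hB : IsCandidateBase B C)
    (hC : IsCandidateBase C B) : C ⊆ (generate hB hC).neg :=
  subset_close

/-- The candidate of the negated type. -/
def swap (p : Candidate) : Candidate where
  pos := p.neg
  neg := p.pos
  isCandidate_pos := p.isCandidate_neg
  isCandidate_neg := p.isCandidate_pos

/-- The candidate of an atomic type. -/
def atom : Candidate := generate (isCandidateBase_empty ∅) (isCandidateBase_empty ∅)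

/-- The candidate of a conjunction: conjunctions are generated by pairs, and their negations,
which are disjunctions, by injections. -/
def and (p q : Candidate) : Candidate :=
  generate (p.isCandidate_pos.isCandidateBase_pairSet q.isCandidate_pos)
    (p.isCandidate_neg.isCandidateBase_injSet q.isCandidate_neg)

/-- The candidate of a disjunction, by De Morgan duality. -/
def or (p q : Candidate) : Candidate := (p.swap.and q.swap).swap

theorem pairSet_subset_and_pos (p q : Candidate) : pairSet p.pos q.pos ⊆ (p.and q).pos :=
  subset_generate_pos _ _

theorem injSet_subset_and_neg (p q : Candidate) : injSet p.neg q.neg ⊆ (p.and q).neg :=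
  subset_generate_neg _ _

theorem injSet_subset_or_pos (p q : Candidate) : injSet p.pos q.pos ⊆ (p.or q).pos :=
  injSet_subset_and_neg p.swap q.swap

end Candidate

variable {α : Type*}

/-- The interpretation of an m-type, together with that of its negation. -/
def MType.sem : MType α → Candidate
  | .atom _ => .atom
  | .natom _ => Candidate.atom.swap
  | .and A B => A.sem.and B.sem
  | .or A B => A.sem.or B.sem

theorem MType.sem_neg (A : MType α) : A.neg.sem = A.sem.swap := by
  induction A with
  | atom | natom => rfl
  | and A B ihA ihB | or A B ihA ihB =>
    simp only [neg, sem, ihA, ihB]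
    rfl

/-- The interpretation of a type, where `⊥` is interpreted by all strongly normalizing terms. -/
def Ty.sem : Ty α → Set Term
  | .m A => A.sem.pos
  | .bot => {M | SN M}

theorem Ty.sn_of_mem_sem {C : Ty α} {M : Term} (h : M ∈ C.sem) : SN M := by
  cases C with
  | m A => exact A.sem.isCandidate_pos.sn h
  | bot => exact h

/-- The substitution `s` replaces each variable declared in `Γ` by a term in the interpretation of
its type. -/
def Realizes (s : ℕ → Term) (Γ : List (MType α)) : Prop :=
  ∀ ⦃n A⦄, Γ[n]? = some A → s n ∈ A.sem.pos

theorem realizes_var (Γ : List (MType α)) : Realizes var Γ :=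
  fun n A _ => A.sem.isCandidate_pos.var_mem n

theorem Realizes.cons {s : ℕ → Term} {Γ : List (MType α)} (hs : Realizes s Γ) {A : MType α}
    {Q : Term} (hQ : Q ∈ A.sem.pos) : Realizes (cons Q s) (A :: Γ)
  | 0, _, rfl => hQ
  | _ + 1, _, h => hs h

theorem HasType.subst_mem_sem {Γ : List (MType α)} {M : Term} {C : Ty α} (h : HasType Γ M C)
    {s : ℕ → Term} (hs : Realizes s Γ) : M.subst s ∈ C.sem := by
  induction h generalizing s with
  | var h => exact hs h
  | pair _ _ ih₁ ih₂ => exact Candidate.pairSet_subset_and_pos _ _ ⟨_, ih₁ hs, _, ih₂ hs, rfl⟩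
  | inj₁ _ ih => exact Candidate.injSet_subset_or_pos _ _ (.inl ⟨_, ih hs, rfl⟩)
  | inj₂ _ ih => exact Candidate.injSet_subset_or_pos _ _ (.inr ⟨_, ih hs, rfl⟩)
  | @lam Γ P A _ ih =>
    have hP : ∀ Q ∈ A.sem.pos, SN ((P.subst (up s)).inst Q) := fun Q hQ => by
      rw [inst_subst_up]
      exact ih (hs.cons hQ)
    rw [Ty.sem, MType.sem_neg]
    exact A.sem.isCandidate_neg.lam_mem hP
  | @star Γ P₁ P₂ A _ _ ih₁ ih₂ =>
    have h₁ : P₁.subst s ∈ A.sem.neg := by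
      have := ih₁ hs
      rwa [Ty.sem, MType.sem_neg] at this
    exact A.sem.isCandidate_neg.orthogonal _ h₁ _ (ih₂ hs)

end LambdaSym

theorem mainTheorem1 {α : Type*} (Γ : List (LambdaSym.MType α)) (M : LambdaSym.Term)
    (C : LambdaSym.Ty α) (hM : LambdaSym.HasType Γ M C) :
    LambdaSym.StronglyNormalizable M := by
  have hmem : M.subst .var ∈ C.sem := hM.subst_mem_sem (LambdaSym.realizes_var Γ)
  rw [M.subst_var] at hmem
  exact LambdaSym.stronglyNormalizable_iff_sn.2 (C.sn_of_mem_sem hmem)
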